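/- Let $\mathcal{E}=(E,\ast)$ be a finite biordered set, i.e. $E$ is the set of idempotents of a semigroup $S$ (not necessarily finite), $E$ is finite, and $\ast$ is the partial operation with $e\ast f=ef$ defined exactly when $\{e,f\}$ is a basic pair, meaning $\{e,f\}\cap\{ef,fe\}\neq\varnothing$. Let $IG(\mathcal{E})=\langle\,\overline{E} : \overline{e}\,\overline{f}=\overline{e\ast f}\text{ whenever }\{e,f\}\text{ is a basic pair}\,\rangle$ be the free idempotent generated semigroup over $\mathcal{E}$, and for a word $w$ in the free semigroup $E^+$ let $\overline{w}$ be the element of $IG(\mathcal{E})$ that it represents. An r-factorisation of $w\in E^+$ is a factorisation $w=w_1\cdots w_m$ into words $w_i\in E^+$ such that every $\overline{w_i}$ is a regular element of $IG(\mathcal{E})$; it is minimal if it is minimal among the r-factorisations of $w$ in the order in which a factorisation lies below another one if its factors are products of consecutive blocks of factors of the other. Let $\mathscr{R},\mathscr{L}$ be Green's relations on $IG(\mathcal{E})$ and $\mathscr{D}=\mathscr{R}\vee\mathscr{L}$. Let $u,v\in E^+$ be such that $\overline{u}=\overline{v}$, and let $u=p_1\cdots p_m$ and $v=q_1\cdots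 q_s$ be arbitrary minimal r-factorisations. Then $m=s$ and $\overline{p_i}\,\mathscr{D}\,\overline{q_i}$ for all $1\leq i\leq m$. Furthermore, $\overline{p_1}\,\mathscr{R}\,\overline{q_1}$ and $\overline{p_m}\,\mathscr{L}\,\overline{q_m}$. Consequently, for every $x\in IG(\mathcal{E})$ there is exactly one sequence of $\mathscr{D}$-classes of $IG(\mathcal{E})$ (the $\mathscr{D}$-fingerprint of $x$) that equals $(D_{\overline{p_1}},\dots,D_{\overline{p_m}})$ for every word $w\in E^+$ with $\overline{w}=x$ and every minimal r-factorisation $w=p_1\cdots p_m$. -/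

import Mathlib

section Green

variable {T : Type*} [Semigroup T]

/-- The principal right ideal `a T¹ = {a} ∪ a T`. -/
def principalRight (a : T) : Set T := {x | x = a ∨ ∃ t : T, x = a * t}

/-- The principal left ideal `T¹ a = {a} ∪ T a`. -/
def principalLeft (a : T) : Set T := {x | x = a ∨ ∃ t : T, x = t * a}

/-- Green's relation `ℛ`: `a ℛ b` iff `a T¹ = b T¹`. -/
def greenR (T : Type*) [Semigroup T] : Setoid T := Setoid.ker principalRight

/-- Green's relation `ℒ`: `a ℒ b` iff `T¹ a = T¹ b`. -/
def greenL (T : Type*) [Semigroup T] : Setoid T := Setoid.ker principalLeft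

/-- Green's relation `𝒟`, the least equivalence containing both `ℛ` and `ℒ`. -/
def greenD (T : Type*) [Semigroup T] : Setoid T := greenR T ⊔ greenL T

/-- `a` is a regular element of the semigroup `T`. -/
def IsRegularElem (a : T) : Prop := ∃ b : T, a * b * a = a

end Green

section Biordered

/-- The set `E` of idempotents of a semigroup `S`. -/
abbrev Idempotents (S : Type*) [Semigroup S] : Type _ := {e : S // IsIdempotentElem e}

variable {S : Type*} [Semigroup S]

/-- `{e, f}` is a basic pair: `{e, f} ∩ {ef, fe} ≠ ∅`. -/
def BasicPair (e f : Idempotents S) : Prop :=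
  (({(e : S), (f : S)} : Set S) ∩ {(e : S) * f, (f : S) * e}).Nonempty

theorem BasicPair.isIdempotentElem_mul {e f : Idempotents S} (h : BasicPair e f) :
    IsIdempotentElem ((e : S) * f) := by
  obtain ⟨e, he⟩ := e
  obtain ⟨f, hf⟩ := f
  simp only [IsIdempotentElem] at he hf ⊢
  obtain ⟨x, hx, hx'⟩ := h
  simp only [Set.mem_insert_iff, Set.mem_singleton_iff] at hx hx'
  rcases hx with rfl | rfl <;> rcases hx' with h | h
  · rw [← h, he]
  · rw [mul_assoc, ← mul_assoc f, ← h, ← mul_assoc, he]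
  · rw [← h, hf]
  · rw [mul_assoc, ← mul_assoc x, ← h, hf]

/-- The partial product `e ∗ f` of the biordered set of `S`, defined exactly on basic pairs, where
it is the product `ef` of `S`. The idempotents of `S` with this partial operation form the
biordered set of `S`. -/
def BasicPair.star {e f : Idempotents S} (h : BasicPair e f) : Idempotents S :=
  ⟨(e : S) * f, h.isIdempotentElem_mul⟩

/-- The defining relations `ē f̄ = (e ∗ f)‾`, for `{e, f}` a basic pair. -/
inductive IGRel (S : Type*) [Semigroup S] :
    FreeSemigroup (Idempotents S) → FreeSemigroup (Idempotents S) → Prop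
  | basic (e f : Idempotents S) (h : BasicPair e f) :
      IGRel S (FreeSemigroup.of e * FreeSemigroup.of f) (FreeSemigroup.of h.star)

/-- The free idempotent generated semigroup `IG(ℰ)` over the biordered set `ℰ` of `S`: the
quotient of the free semigroup `E⁺` by the congruence generated by the defining relations. -/
def IG (S : Type*) [Semigroup S] : Type _ := (conGen (IGRel S)).Quotient

instance (S : Type*) [Semigroup S] : Semigroup (IG S) :=
  inferInstanceAs (Semigroup (conGen (IGRel S)).Quotient)

/-- The natural homomorphism `w ↦ w̄` from `E⁺` to `IG(ℰ)`. -/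
def IG.bar : FreeSemigroup (Idempotents S) →ₙ* IG S where
  toFun w := ((w : (conGen (IGRel S)).Quotient) : IG S)
  map_mul' _ _ := rfl

end Biordered

section Factorisations

/-- The nonempty list of letters of a word of the free semigroup. -/
def FreeSemigroup.letters {A : Type*} (w : FreeSemigroup A) : List A := w.head :: w.tail

/-- `w = p₁ ⋯ pₘ`, for a sequence `(p₁, …, pₘ)` of nonempty words (so `1 ≤ m`, as `w` is
nonempty). -/
def IsFactorisation {A : Type*} (w : FreeSemigroup A) (p : List (FreeSemigroup A)) : Prop :=
  (p.map FreeSemigroup.letters).flatten = w.letters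

/-- `p ≼ q`: the sequence `p` is coarser than `q`, i.e. `q` can be cut into consecutive nonempty
blocks whose products are, in order, the members of `p`. -/
def Coarser {A : Type*} (p q : List (FreeSemigroup A)) : Prop :=
  ∃ blocks : List (List (FreeSemigroup A)),
    blocks.flatten = q ∧ List.Forall₂ IsFactorisation p blocks

variable {S : Type*} [Semigroup S]

/-- `p` is an r-factorisation of `w`: every factor represents a regular element of `IG(ℰ)`. -/
def IsRFactorisation (w : FreeSemigroup (Idempotents S))
    (p : List (FreeSemigroup (Idempotents S))) : Prop :=
  IsFactorisation w p ∧ ∀ x ∈ p, IsRegularElem (IG.bar x)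

/-- `p` is a minimal r-factorisation of `w`: minimal for `≼` among the r-factorisations of `w`. -/
def IsMinimalRFactorisation (w : FreeSemigroup (Idempotents S))
    (p : List (FreeSemigroup (Idempotents S))) : Prop :=
  IsRFactorisation w p ∧ ∀ q, IsRFactorisation w q → Coarser q p → q = p

theorem IsMinimalRFactorisation.ne_nil {w : FreeSemigroup (Idempotents S)}
    {p : List (FreeSemigroup (Idempotents S))} (h : IsMinimalRFactorisation w p) : p ≠ [] := by
  rintro rfl
  have h1 : IsFactorisation w [] := h.1.1
  simp [IsFactorisation, FreeSemigroup.letters] at h1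

/-- The sequence of the `𝒟`-classes, in `IG(ℰ)`, of the elements represented by the members
of `p`. -/
def dClasses (p : List (FreeSemigroup (Idempotents S))) : List (Quotient (greenD (IG S))) :=
  p.map fun x => Quotient.mk (greenD (IG S)) (IG.bar x)

end Factorisations

/-! ### Green's relations in a monoid, as divisibility -/

section GreenMonoid

variable {M : Type*} [Monoid M] {a b c : M}

/-! Regularity is replaced by a condition visible on words: a seed is a letter `t` of `w = a t b`
with `a t ℒ t ℛ t b`. Computations take place in `IG(ℰ)¹`, where Green's relations are divisibility
statements.

Having a seed survives each elementary rewriting `e f ↔ e ∗ f`, so it depends only on the element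
represented (`hasSeed_congr`), and only on its `ℛ`-class or `ℒ`-class. It turns out to be equivalent
to regularity (`isRegularElem_bar_iff_hasSeed`), so the factors of a minimal r-factorisation have
seeds while no product of two neighbours does: the sequence is reduced.

Everything then rests on one move, `IsSeedReduced.shift`: letters may cross the border between
neighbours `a`, `b` if the `ℛ`-class of `a`, the `ℒ`-class of `b` and the product are kept. This
preserves reducedness and the fingerprint. Any two reduced factorisations of one word are linked by
such shifts (`sameFingerprint_of_flatten_eq`), and a reduced factorisation can be carried along
every rewriting (`IsSeedReduced.exists_of_basicStep` and its converse). Hence reduced factorisations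
of equal elements have the same fingerprint. The same invariance, in particular that of the length,
is what proves that idempotents have seeds. -/

theorem greenR_iff_dvd : greenR M a b ↔ a ∣ b ∧ b ∣ a := by
  have key : ∀ a : M, principalRight a = {x | a ∣ x} := fun a => by
    ext x
    constructor
    · rintro (rfl | ⟨t, rfl⟩)
      exacts [dvd_rfl, dvd_mul_right _ _]
    · rintro ⟨t, rfl⟩
      exact Or.inr ⟨t, rfl⟩
  change principalRight a = principalRight b ↔ _
  rw [key, key]
  constructor
  · intro h
    exact ⟨(Set.ext_iff.1 h b).2 dvd_rfl, (Set.ext_iff.1 h a).1 dvd_rfl⟩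
  · rintro ⟨h1, h2⟩
    ext x
    exact ⟨h2.trans, h1.trans⟩

theorem greenL_iff_exists : greenL M a b ↔ (∃ c, b = c * a) ∧ ∃ c, a = c * b := by
  have key : ∀ a : M, principalLeft a = {x | ∃ t, x = t * a} := fun a => by
    ext x
    constructor
    · rintro (rfl | ⟨t, rfl⟩)
      exacts [⟨1, (one_mul _).symm⟩, ⟨t, rfl⟩]
    · rintro ⟨t, rfl⟩
      exact Or.inr ⟨t, rfl⟩
  change principalLeft a = principalLeft b ↔ _
  rw [key, key]
  constructor
  · intro h
    exact ⟨(Set.ext_iff.1 h b).2 ⟨1, (one_mul _).symm⟩,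
      (Set.ext_iff.1 h a).1 ⟨1, (one_mul _).symm⟩⟩
  · rintro ⟨⟨c, hc⟩, ⟨d, hd⟩⟩
    ext x
    constructor
    · rintro ⟨t, rfl⟩
      exact ⟨t * d, by rw [mul_assoc, ← hd]⟩
    · rintro ⟨t, rfl⟩
      exact ⟨t * c, by rw [mul_assoc, ← hc]⟩

theorem greenR_mul_left (c : M) (h : greenR M a b) : greenR M (c * a) (c * b) := by
  rw [greenR_iff_dvd] at h ⊢
  exact ⟨mul_dvd_mul_left c h.1, mul_dvd_mul_left c h.2⟩

theorem greenL_mul_right (c : M) (h : greenL M a b) : greenL M (a * c) (b * c) := by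
  rw [greenL_iff_exists] at h ⊢
  obtain ⟨⟨x, hx⟩, ⟨y, hy⟩⟩ := h
  exact ⟨⟨x, by rw [← mul_assoc, ← hx]⟩, ⟨y, by rw [← mul_assoc, ← hy]⟩⟩

theorem greenR_mul_of_greenR_mul_mul (h : greenR M a (a * (b * c))) : greenR M a (a * b) := by
  rw [greenR_iff_dvd] at h ⊢
  exact ⟨dvd_mul_right _ _, dvd_trans ⟨c, mul_assoc _ _ _ |>.symm⟩ h.2⟩

theorem greenL_mul_of_greenL_mul_mul (h : greenL M a (c * b * a)) : greenL M a (b * a) := by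
  rw [greenL_iff_exists] at h ⊢
  obtain ⟨-, ⟨y, hy⟩⟩ := h
  exact ⟨⟨b, rfl⟩, ⟨y * c, by rw [mul_assoc, ← mul_assoc c]; exact hy⟩⟩

end GreenMonoid

/-! ### Descent from the monoid with adjoined identity -/

section GreenWithOne

variable {T : Type*} [Semigroup T] {a b : T}

theorem greenR_of_greenR_coe (h : greenR (WithOne T) (a : WithOne T) b) : greenR T a b := by
  have key : ∀ a x : T, (x ∈ principalRight a ↔ (a : WithOne T) ∣ x) := fun a x => by
    constructor
    · rintro (rfl | ⟨t, rfl⟩)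
      exacts [dvd_rfl, ⟨t, WithOne.coe_mul _ _⟩]
    · rintro ⟨t, ht⟩
      induction t using WithOne.recOneCoe with
      | one => exact Or.inl (WithOne.coe_inj.1 (by simpa using ht))
      | coe t => exact Or.inr ⟨t, WithOne.coe_inj.1 (by rw [ht, WithOne.coe_mul])⟩
  rw [greenR_iff_dvd] at h
  exact Set.ext fun x => by rw [key, key]; exact ⟨h.2.trans, h.1.trans⟩

theorem greenL_of_greenL_coe (h : greenL (WithOne T) (a : WithOne T) b) : greenL T a b := by
  have key : ∀ a x : T, (x ∈ principalLeft a ↔ ∃ t : WithOne T, (x : WithOne T) = t * a) :=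
    fun a x => by
    constructor
    · rintro (rfl | ⟨t, rfl⟩)
      exacts [⟨1, (one_mul _).symm⟩, ⟨t, WithOne.coe_mul _ _⟩]
    · rintro ⟨t, ht⟩
      induction t using WithOne.recOneCoe with
      | one => exact Or.inl (WithOne.coe_inj.1 (by simpa using ht))
      | coe t => exact Or.inr ⟨t, WithOne.coe_inj.1 (by rw [ht, WithOne.coe_mul])⟩
  rw [greenL_iff_exists] at h
  obtain ⟨⟨c, hc⟩, ⟨d, hd⟩⟩ := h
  refine Set.ext fun x => ?_
  rw [key, key]
  constructor
  · rintro ⟨t, ht⟩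
    exact ⟨t * d, by rw [mul_assoc, ← hd, ht]⟩
  · rintro ⟨t, ht⟩
    exact ⟨t * c, by rw [mul_assoc, ← hc, ht]⟩

/-- The adjoined identity has no proper divisors, so it is alone in its `ℛ`- and `ℒ`-classes. The
equivalence `s` that isolates it and is `𝒟` elsewhere therefore contains `ℛ` and `ℒ`, hence their
join. -/
theorem greenD_of_greenD_coe (h : greenD (WithOne T) (a : WithOne T) b) : greenD T a b := by
  let s : Setoid (WithOne T) :=
    { r := fun x y => (x = 1 ∧ y = 1) ∨
        ∃ x' y' : T, x = x' ∧ y = y' ∧ greenD T x' y'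
      iseqv :=
        { refl := fun x => by
            induction x using WithOne.recOneCoe with
            | one => exact Or.inl ⟨rfl, rfl⟩
            | coe x => exact Or.inr ⟨x, x, rfl, rfl, Setoid.refl' _ x⟩
          symm := by
            rintro x y (⟨h1, h2⟩ | ⟨x', y', h1, h2, h⟩)
            exacts [Or.inl ⟨h2, h1⟩, Or.inr ⟨y', x', h2, h1, Setoid.symm' _ h⟩]
          trans := by
            rintro x y z (⟨h1, h2⟩ | ⟨x', y', rfl, rfl, h⟩) (⟨h3, h4⟩ | ⟨y'', z', h3, rfl, h'⟩)
            · exact Or.inl ⟨h1, h4⟩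
            · exact absurd (h3.symm.trans h2) WithOne.coe_ne_one
            · exact absurd h3 WithOne.coe_ne_one
            · obtain rfl := WithOne.coe_inj.1 h3
              exact Or.inr ⟨x', z', rfl, rfl, Setoid.trans' _ h h'⟩ } }
  have hR : greenR (WithOne T) ≤ s := by
    intro x y hxy
    induction x using WithOne.recOneCoe <;> induction y using WithOne.recOneCoe
    · exact Or.inl ⟨rfl, rfl⟩
    · obtain ⟨-, t, ht⟩ := greenR_iff_dvd.1 hxy
      induction t using WithOne.recOneCoe <;> simp [← WithOne.coe_mul] at ht
    · obtain ⟨⟨t, ht⟩, -⟩ := greenR_iff_dvd.1 hxy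
      induction t using WithOne.recOneCoe <;> simp [← WithOne.coe_mul] at ht
    · exact Or.inr ⟨_, _, rfl, rfl, (le_sup_left : greenR T ≤ greenD T) (greenR_of_greenR_coe hxy)⟩
  have hL : greenL (WithOne T) ≤ s := by
    intro x y hxy
    induction x using WithOne.recOneCoe <;> induction y using WithOne.recOneCoe
    · exact Or.inl ⟨rfl, rfl⟩
    · obtain ⟨-, t, ht⟩ := greenL_iff_exists.1 hxy
      induction t using WithOne.recOneCoe <;> simp [← WithOne.coe_mul] at ht
    · obtain ⟨⟨t, ht⟩, -⟩ := greenL_iff_exists.1 hxy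
      induction t using WithOne.recOneCoe <;> simp [← WithOne.coe_mul] at ht
    · exact Or.inr ⟨_, _, rfl, rfl, (le_sup_right : greenL T ≤ greenD T) (greenL_of_greenL_coe hxy)⟩
  obtain ⟨h1, -⟩ | ⟨x, y, h1, h2, h⟩ := (sup_le hR hL : greenD (WithOne T) ≤ s) h
  · exact absurd h1 WithOne.coe_ne_one
  · rwa [WithOne.coe_inj.1 h1, WithOne.coe_inj.1 h2]

end GreenWithOne

/-! ### Words, their values, and elementary rewriting -/

section Words

variable {S : Type*} [Semigroup S]

/-- The value in `IG(ℰ)¹` of a letter. -/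
def letterVal (e : Idempotents S) : WithOne (IG S) := (IG.bar (FreeSemigroup.of e) : IG S)

/-- The value in `IG(ℰ)¹` of a possibly empty word. -/
def wordVal (w : List (Idempotents S)) : WithOne (IG S) := (w.map letterVal).prod

@[simp] theorem wordVal_nil : wordVal ([] : List (Idempotents S)) = 1 := rfl

@[simp] theorem wordVal_cons (e : Idempotents S) (w : List (Idempotents S)) :
    wordVal (e :: w) = letterVal e * wordVal w := by simp [wordVal]

@[simp] theorem wordVal_append (u v : List (Idempotents S)) :
    wordVal (u ++ v) = wordVal u * wordVal v := by simp [wordVal]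

theorem letters_mul {A : Type*} (u v : FreeSemigroup A) :
    (u * v).letters = u.letters ++ v.letters := rfl

theorem exists_letters_eq {A : Type*} {w : List A} (hw : w ≠ []) :
    ∃ u : FreeSemigroup A, u.letters = w := by
  cases w with
  | nil => exact absurd rfl hw
  | cons a w => exact ⟨⟨a, w⟩, rfl⟩

theorem letters_ne_nil {A : Type*} (u : FreeSemigroup A) : u.letters ≠ [] :=
  List.cons_ne_nil _ _

theorem letters_injective {A : Type*} :
    Function.Injective (FreeSemigroup.letters : FreeSemigroup A → List A) := by
  rintro ⟨a, u⟩ ⟨b, v⟩ h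
  simp only [FreeSemigroup.letters, List.cons.injEq] at h
  rw [h.1, h.2]

theorem wordVal_letters (u : FreeSemigroup (Idempotents S)) :
    wordVal u.letters = (IG.bar u : IG S) := by
  induction u using FreeSemigroup.recOnMul with
  | ih1 e => simp [FreeSemigroup.letters, FreeSemigroup.of, letterVal]
  | ih2 e u he hu => rw [letters_mul, wordVal_append, he, hu, map_mul, WithOne.coe_mul]

theorem wordVal_surjective : Function.Surjective (wordVal (S := S)) := by
  intro z
  induction z using WithOne.recOneCoe with
  | one => exact ⟨[], rfl⟩
  | coe z =>
    obtain ⟨u, rfl⟩ : ∃ u, IG.bar u = z := Quot.exists_rep z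
    exact ⟨u.letters, wordVal_letters u⟩

theorem letterVal_mul_of_basicPair {e f : Idempotents S} (h : BasicPair e f) :
    letterVal e * letterVal f = letterVal h.star := by
  rw [letterVal, letterVal, ← WithOne.coe_mul, ← map_mul, letterVal, WithOne.coe_inj]
  exact (Con.eq _).2 (ConGen.Rel.of _ _ (IGRel.basic e f h))

theorem basicPair_self (e : Idempotents S) : BasicPair e e :=
  ⟨e, by simp, by simp [e.2.eq]⟩

theorem letterVal_mul_self (e : Idempotents S) : letterVal e * letterVal e = letterVal e := by
  rw [letterVal_mul_of_basicPair (basicPair_self e)]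
  congr 1
  exact Subtype.ext e.2.eq

theorem BasicPair.symm {e f : Idempotents S} (h : BasicPair e f) : BasicPair f e := by
  unfold BasicPair at h ⊢
  rwa [Set.pair_comm, Set.pair_comm ((f : S) * e)]

/-- If `fe = e`, then `(ef)e = e`; if `fe = f`, then `f(ef) = f`; the cases `ef = e` and `ef = f`
are immediate. This decides which of the two letters takes over the role of `e ∗ f`. -/
theorem BasicPair.greenR_or_greenL {e f : Idempotents S} (h : BasicPair e f) :
    greenR _ (letterVal e) (letterVal h.star) ∨ greenL _ (letterVal f) (letterVal h.star) := by
  have h' := h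
  obtain ⟨x, hx, hx'⟩ := h'
  simp only [Set.mem_insert_iff, Set.mem_singleton_iff] at hx hx'
  rcases hx with rfl | rfl <;> rcases hx' with hx | hx
  · left
    rw [show h.star = e from Subtype.ext hx.symm]
  · left
    have h1 : letterVal f * letterVal e = letterVal e := by
      rw [letterVal_mul_of_basicPair h.symm, show h.symm.star = e from Subtype.ext hx.symm]
    rw [greenR_iff_dvd, ← letterVal_mul_of_basicPair h]
    exact ⟨dvd_mul_right _ _, letterVal e, by rw [mul_assoc, h1, letterVal_mul_self]⟩
  · right
    rw [show h.star = f from Subtype.ext hx.symm]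
  · right
    have h1 : letterVal f * letterVal e = letterVal f := by
      rw [letterVal_mul_of_basicPair h.symm, show h.symm.star = f from Subtype.ext hx.symm]
    rw [greenL_iff_exists, ← letterVal_mul_of_basicPair h]
    exact ⟨⟨_, rfl⟩, letterVal f, by rw [← mul_assoc, h1, letterVal_mul_self]⟩

/-- An elementary step: two consecutive letters that form a basic pair are replaced by their
product. -/
inductive BasicStep : List (Idempotents S) → List (Idempotents S) → Prop
  | mk (x : List (Idempotents S)) (e f : Idempotents S) (h : BasicPair e f)
      (y : List (Idempotents S)) : BasicStep (x ++ e :: f :: y) (x ++ h.star :: y)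

theorem BasicStep.append {u v : List (Idempotents S)} (h : BasicStep u v)
    (a b : List (Idempotents S)) : BasicStep (a ++ u ++ b) (a ++ v ++ b) := by
  obtain ⟨x, e, f, h, y⟩ := h
  simpa using BasicStep.mk (a ++ x) e f h (y ++ b)

theorem eqvGen_append {u v : List (Idempotents S)} (h : Relation.EqvGen BasicStep u v)
    (a b : List (Idempotents S)) : Relation.EqvGen BasicStep (a ++ u ++ b) (a ++ v ++ b) := by
  induction h with
  | rel _ _ h => exact .rel _ _ (h.append a b)
  | refl _ => exact .refl _
  | symm _ _ _ ih => exact .symm _ _ ih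
  | trans _ _ _ _ _ ih1 ih2 => exact .trans _ _ _ ih1 ih2

theorem eqvGen_basicStep_of_wordVal_eq {u v : List (Idempotents S)}
    (h : wordVal u = wordVal v) : Relation.EqvGen BasicStep u v := by
  by_cases hu : u = []
  · by_cases hv : v = []
    · rw [hu, hv]
      exact .refl _
    · obtain ⟨v, rfl⟩ := exists_letters_eq hv
      rw [hu, wordVal_letters] at h
      exact absurd h.symm WithOne.coe_ne_one
  by_cases hv : v = []
  · obtain ⟨u, rfl⟩ := exists_letters_eq hu
    rw [hv, wordVal_letters] at h
    exact absurd h WithOne.coe_ne_one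
  obtain ⟨u, rfl⟩ := exists_letters_eq hu
  obtain ⟨v, rfl⟩ := exists_letters_eq hv
  rw [wordVal_letters, wordVal_letters, WithOne.coe_inj] at h
  -- The equivalence generated by elementary steps is itself a congruence, so it contains the one
  -- defining `IG(ℰ)`.
  let c : Con (FreeSemigroup (Idempotents S)) :=
    { r := fun u v => Relation.EqvGen BasicStep u.letters v.letters
      iseqv := ⟨fun _ => .refl _, fun h => .symm _ _ h, fun h h' => .trans _ _ _ h h'⟩
      mul' := by
        intro w x y z h1 h2
        rw [letters_mul, letters_mul]
        have h3 := eqvGen_append h1 [] y.letters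
        have h4 := eqvGen_append h2 x.letters []
        simp only [List.nil_append, List.append_nil] at h3 h4
        exact .trans _ _ _ h3 h4 }
  have hc : conGen (IGRel S) ≤ c := Con.conGen_le.2 <| by
    rintro _ _ ⟨e, f, h⟩
    exact .rel _ _ (BasicStep.mk [] e f h [])
  exact hc ((Con.eq _).1 h)

end Words

/-! ### Seeds and their invariance -/

section Seeds

variable {S : Type*} [Semigroup S]

/-- A word has a seed if it is `a t b`, with `t` a letter such that `a t ℒ t ℛ t b` in `IG(ℰ)`. -/
def HasSeed (w : List (Idempotents S)) : Prop :=
  ∃ a t b, w = a ++ t :: b ∧ greenL _ (letterVal t) (wordVal a * letterVal t) ∧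
    greenR _ (letterVal t) (letterVal t * wordVal b)

theorem HasSeed.ne_nil {w : List (Idempotents S)} (h : HasSeed w) : w ≠ [] := by
  obtain ⟨a, t, b, rfl, -⟩ := h
  simp

theorem hasSeed_singleton (e : Idempotents S) : HasSeed [e] :=
  ⟨[], e, [], rfl, by simp, by simp⟩

/-- A seed outside the rewritten place stays a seed. A seed `e` or `f` passes to `e ∗ f`;
conversely, a seed `e ∗ f` passes to `e` if they are `ℛ`-related and to `f` if they are `ℒ`-related.
-/
theorem hasSeed_of_basicStep {u v : List (Idempotents S)} (h : BasicStep u v) :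
    HasSeed u ↔ HasSeed v := by
  obtain ⟨x, e, f, h, y⟩ := h
  have hg := letterVal_mul_of_basicPair h
  constructor
  · rintro ⟨a, t, b, hw, hl, hr⟩
    have he : e = t → x = a → f :: y = b → HasSeed (x ++ h.star :: y) := by
      rintro rfl rfl rfl
      refine ⟨_, _, _, rfl, ?_, ?_⟩
      · rw [← hg, ← mul_assoc]
        exact greenL_mul_right _ hl
      · rw [← hg, mul_assoc]
        rw [wordVal_cons] at hr
        exact Setoid.trans' _ (Setoid.symm' _ (greenR_mul_of_greenR_mul_mul hr)) hr
    rcases List.append_eq_append_iff.1 hw with ⟨a', rfl, h2⟩ | ⟨c, rfl, h2⟩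
    · rcases a' with - | ⟨_, - | ⟨_, a'⟩⟩
      · simp only [List.nil_append, List.cons.injEq] at h2
        exact he h2.1 (by simp) h2.2
      · simp only [List.cons_append, List.nil_append, List.cons.injEq] at h2
        obtain ⟨rfl, rfl, rfl⟩ := h2
        refine ⟨_, _, _, rfl, ?_, ?_⟩
        · rw [← hg, ← mul_assoc]
          rw [wordVal_append, wordVal_cons, wordVal_nil, mul_one] at hl
          exact Setoid.trans' _ (Setoid.symm' _ (greenL_mul_of_greenL_mul_mul hl)) hl
        · rw [← hg, mul_assoc]
          exact greenR_mul_left _ hr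
      · simp only [List.cons_append, List.cons.injEq] at h2
        obtain ⟨rfl, rfl, rfl⟩ := h2
        refine ⟨x ++ h.star :: a', t, b, by simp, ?_, hr⟩
        simpa [← hg, mul_assoc] using hl
    · rcases c with - | ⟨_, c⟩
      · simp only [List.nil_append, List.cons.injEq] at h2
        exact he h2.1.symm (by simp) h2.2.symm
      · simp only [List.cons_append, List.cons.injEq] at h2
        obtain ⟨rfl, rfl⟩ := h2
        refine ⟨a, t, c ++ h.star :: y, by simp, hl, ?_⟩
        simpa [← hg, mul_assoc] using hr
  · rintro ⟨a, t, b, hw, hl, hr⟩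
    have he : h.star = t → x = a → y = b → HasSeed (x ++ e :: f :: y) := by
      rintro rfl rfl rfl
      rcases h.greenR_or_greenL with h1 | h1
      · refine ⟨x, e, f :: y, rfl, ?_, ?_⟩
        · obtain ⟨-, z, hz⟩ := greenR_iff_dvd.1 h1
          have := greenL_mul_right z hl
          rwa [mul_assoc, ← hz] at this
        · rw [wordVal_cons, ← mul_assoc, hg]
          exact Setoid.trans' _ h1 hr
      · refine ⟨x ++ [e], f, y, by simp, ?_, ?_⟩
        · simp only [wordVal_append, wordVal_cons, wordVal_nil, mul_one, mul_assoc, hg]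
          exact Setoid.trans' _ h1 hl
        · obtain ⟨-, z, hz⟩ := greenL_iff_exists.1 h1
          have := greenR_mul_left z hr
          rwa [← mul_assoc, ← hz] at this
    rcases List.append_eq_append_iff.1 hw with ⟨a', rfl, h2⟩ | ⟨c, rfl, h2⟩
    · rcases a' with - | ⟨_, a'⟩
      · simp only [List.nil_append, List.cons.injEq] at h2
        exact he h2.1 (by simp) h2.2
      · simp only [List.cons_append, List.cons.injEq] at h2
        obtain ⟨rfl, rfl⟩ := h2
        refine ⟨x ++ e :: f :: a', t, b, by simp, ?_, hr⟩
        simpa [← hg, mul_assoc] using hl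
    · rcases c with - | ⟨_, c⟩
      · simp only [List.nil_append, List.cons.injEq] at h2
        exact he h2.1.symm (by simp) h2.2.symm
      · simp only [List.cons_append, List.cons.injEq] at h2
        obtain ⟨rfl, rfl⟩ := h2
        refine ⟨a, t, c ++ e :: f :: y, by simp, hl, ?_⟩
        simpa [← hg, mul_assoc] using hr

theorem hasSeed_congr {u v : List (Idempotents S)} (h : wordVal u = wordVal v) :
    HasSeed u ↔ HasSeed v := by
  have h' := eqvGen_basicStep_of_wordVal_eq h
  clear h
  induction h' with
  | rel _ _ h => exact hasSeed_of_basicStep h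
  | refl _ => rfl
  | symm _ _ _ ih => exact ih.symm
  | trans _ _ _ _ _ ih1 ih2 => exact ih1.trans ih2

/-- Write the second element as `a t b x`. As `t` is a left multiple of `a t`, cancelling `a` turns
`a t b ℛ a t b x` into `t b ℛ t b x`, so `t` is still a seed. -/
theorem HasSeed.of_greenR {u v : List (Idempotents S)} (hu : HasSeed u)
    (h : greenR _ (wordVal u) (wordVal v)) : HasSeed v := by
  obtain ⟨a, t, b, rfl, hl, hr⟩ := hu
  obtain ⟨⟨x, hx⟩, ⟨y, hy⟩⟩ := greenR_iff_dvd.1 h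
  obtain ⟨x, rfl⟩ := wordVal_surjective x
  rw [hasSeed_congr (v := (a ++ t :: b) ++ x) (by rw [wordVal_append, hx])]
  refine ⟨a, t, b ++ x, by simp, hl, Setoid.trans' _ hr ?_⟩
  obtain ⟨-, c, hc⟩ := greenL_iff_exists.1 hl
  have key : letterVal t * wordVal b = letterVal t * wordVal (b ++ x) * y := by
    have h1 : letterVal t * wordVal b = c * wordVal (a ++ t :: b) := by
      rw [wordVal_append, wordVal_cons, ← mul_assoc (wordVal a), ← mul_assoc c, ← hc]
    rw [h1, hy, hx, ← mul_assoc, ← mul_assoc, ← h1, wordVal_append, mul_assoc (letterVal t)]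
  rw [greenR_iff_dvd]
  exact ⟨⟨wordVal x, by rw [wordVal_append, mul_assoc]⟩, ⟨y, key⟩⟩

theorem HasSeed.of_greenL {u v : List (Idempotents S)} (hu : HasSeed u)
    (h : greenL _ (wordVal u) (wordVal v)) : HasSeed v := by
  obtain ⟨a, t, b, rfl, hl, hr⟩ := hu
  obtain ⟨⟨x, hx⟩, ⟨y, hy⟩⟩ := greenL_iff_exists.1 h
  obtain ⟨x, rfl⟩ := wordVal_surjective x
  rw [hasSeed_congr (v := x ++ (a ++ t :: b)) (by rw [wordVal_append, hx])]
  refine ⟨x ++ a, t, b, by simp, Setoid.trans' _ hl ?_, hr⟩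
  obtain ⟨-, c, hc⟩ := greenR_iff_dvd.1 hr
  have key : wordVal a * letterVal t = y * (wordVal (x ++ a) * letterVal t) := by
    have h1 : wordVal a * letterVal t = wordVal (a ++ t :: b) * c := by
      rw [wordVal_append, wordVal_cons, mul_assoc, ← hc]
    rw [h1, hy, hx, mul_assoc, mul_assoc, ← h1, wordVal_append, mul_assoc (wordVal x)]
  rw [greenL_iff_exists]
  exact ⟨⟨wordVal x, by rw [wordVal_append, mul_assoc]⟩, ⟨y, key⟩⟩

end Seeds

/-! ### Reduced sequences and invariance of the fingerprint -/

section Reduced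

variable {S : Type*} [Semigroup S]

/-- A sequence of words is reduced if its members have seeds, but no product of two consecutive
members does. -/
def IsSeedReduced (p : List (List (Idempotents S))) : Prop :=
  (∀ x ∈ p, HasSeed x) ∧ p.IsChain fun x y => ¬ HasSeed (x ++ y)

/-- The members of `p` and `q` are pairwise `𝒟`-related, the first ones even `ℛ`-related, and the
last ones even `ℒ`-related. -/
structure SameFingerprint (p q : List (List (Idempotents S))) : Prop where
  greenD : List.Forall₂ (fun x y => greenD (WithOne (IG S)) (wordVal x) (wordVal y)) p q
  greenR : ∀ x ∈ p.head?, ∀ y ∈ q.head?, greenR (WithOne (IG S)) (wordVal x) (wordVal y)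
  greenL : ∀ x ∈ p.getLast?, ∀ y ∈ q.getLast?, greenL (WithOne (IG S)) (wordVal x) (wordVal y)

namespace SameFingerprint

variable {p q r : List (List (Idempotents S))}

theorem refl (p : List (List (Idempotents S))) : SameFingerprint p p where
  greenD := List.forall₂_same.2 fun _ _ => Setoid.refl' _ _
  greenR x hx y hy := by
    obtain rfl := Option.mem_unique hx hy
    exact Setoid.refl' _ _
  greenL x hx y hy := by
    obtain rfl := Option.mem_unique hx hy
    exact Setoid.refl' _ _

theorem symm (h : SameFingerprint p q) : SameFingerprint q p where
  greenD := List.Forall₂.flip (h.greenD.imp fun _ _ h => Setoid.symm' _ h)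
  greenR x hx y hy := Setoid.symm' _ (h.greenR y hy x hx)
  greenL x hx y hy := Setoid.symm' _ (h.greenL y hy x hx)

theorem length_eq (h : SameFingerprint p q) : p.length = q.length := h.greenD.length_eq

theorem trans (h : SameFingerprint p q) (h' : SameFingerprint q r) : SameFingerprint p r := by
  refine ⟨?_, ?_, ?_⟩
  · rw [List.forall₂_iff_get]
    obtain ⟨h1, h2⟩ := List.forall₂_iff_get.1 h.greenD
    obtain ⟨h3, h4⟩ := List.forall₂_iff_get.1 h'.greenD
    exact ⟨h1.trans h3, fun i hi hi' => Setoid.trans' _ (h2 i hi (h1 ▸ hi)) (h4 i (h1 ▸ hi) hi')⟩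
  · intro x hx z hz
    rcases q with - | ⟨y, q⟩
    · have := List.length_eq_zero_iff.1 h.length_eq
      simp [this] at hx
    · exact Setoid.trans' _ (h.greenR x hx y rfl) (h'.greenR y rfl z hz)
  · intro x hx z hz
    rcases List.eq_nil_or_concat q with rfl | ⟨q, y, rfl⟩
    · have := List.length_eq_zero_iff.1 h.length_eq
      simp [this] at hx
    · exact Setoid.trans' _ (h.greenL x hx y (by simp)) (h'.greenL y (by simp) z hz)

theorem cons (a : List (Idempotents S)) (h : SameFingerprint p q) :
    SameFingerprint (a :: p) (a :: q) := by
  refine ⟨.cons (Setoid.refl' _ _) h.greenD, ?_, ?_⟩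
  · rintro x ⟨⟩ y ⟨⟩
    exact Setoid.refl' _ _
  · intro x hx y hy
    have hl := h.length_eq
    rcases List.eq_nil_or_concat p with rfl | ⟨p, z, rfl⟩
    · obtain rfl := List.length_eq_zero_iff.1 hl.symm
      obtain rfl := Option.mem_unique hx hy
      exact Setoid.refl' _ _
    · rcases List.eq_nil_or_concat q with rfl | ⟨q, z', rfl⟩
      · simp at hl
      · refine h.greenL x ?_ y ?_
        · simpa [List.getLast?_cons] using hx
        · simpa [List.getLast?_cons] using hy

theorem append_left (P : List (List (Idempotents S))) (h : SameFingerprint p q) :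
    SameFingerprint (P ++ p) (P ++ q) := by
  induction P with
  | nil => exact h
  | cons a P ih => exact ih.cons a

end SameFingerprint

variable {P Q : List (List (Idempotents S))} {a b a' b' : List (Idempotents S)}

theorem IsSeedReduced.ne_nil {p : List (List (Idempotents S))} (h : IsSeedReduced p) :
    ∀ x ∈ p, x ≠ [] := fun x hx => (h.1 x hx).ne_nil

theorem IsSeedReduced.of_append_left (h : IsSeedReduced (P ++ Q)) : IsSeedReduced P :=
  ⟨fun x hx => h.1 x (List.mem_append_left _ hx), (List.isChain_append.1 h.2).1⟩

theorem IsSeedReduced.of_append_right (h : IsSeedReduced (P ++ Q)) : IsSeedReduced Q :=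
  ⟨fun x hx => h.1 x (List.mem_append_right _ hx), (List.isChain_append.1 h.2).2.1⟩

theorem isSeedReduced_singleton (h : HasSeed a) : IsSeedReduced [a] :=
  ⟨by simpa using h, by simp⟩

theorem IsSeedReduced.not_hasSeed (h : IsSeedReduced (P ++ a :: b :: Q)) : ¬ HasSeed (a ++ b) :=
  List.isChain_iff_forall_rel_of_append_cons_cons.1 h.2 rfl

theorem IsSeedReduced.replace (h : IsSeedReduced (P ++ a :: Q)) (ha : wordVal a = wordVal a') :
    IsSeedReduced (P ++ a' :: Q) ∧ SameFingerprint (P ++ a :: Q) (P ++ a' :: Q) := by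
  constructor
  · obtain ⟨h1, h2⟩ := h
    simp only [List.mem_append, List.mem_cons, List.isChain_append, List.isChain_cons] at h1 h2
    refine ⟨?_, ?_⟩
    · intro x hx
      simp only [List.mem_append, List.mem_cons] at hx
      rcases hx with hx | rfl | hx
      · exact h1 x (by simp [hx])
      · exact (hasSeed_congr ha).1 (h1 a (by simp))
      · exact h1 x (by simp [hx])
    · simp only [List.isChain_append, List.isChain_cons]
      refine ⟨h2.1, ⟨fun y hy => ?_, h2.2.1.2⟩, ?_⟩
      · rw [hasSeed_congr (v := a ++ y) (by simp [ha])]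
        exact h2.2.1.1 y hy
      · rintro x hx _ ⟨⟩
        rw [hasSeed_congr (v := x ++ a) (by simp [ha])]
        exact h2.2.2 x hx a rfl
  · refine SameFingerprint.append_left P ⟨.cons ?_ (SameFingerprint.refl Q).greenD, ?_, ?_⟩
    · rw [ha]
    · rintro x ⟨⟩ y ⟨⟩
      rw [ha]
    · intro x hx y hy
      rcases List.eq_nil_or_concat Q with rfl | ⟨Q, z, rfl⟩
      · obtain rfl : a = x := by simpa using hx
        obtain rfl : a' = y := by simpa using hy
        rw [ha]
      · obtain rfl : z = x := by simpa [List.getLast?_cons] using hx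
        obtain rfl : z = y := by simpa [List.getLast?_cons] using hy
        exact Setoid.refl' _ _

/-- Seeds are invariant under `ℛ` and `ℒ`. The product with the previous member changes within its
`ℛ`-class, the product with the next one within its `ℒ`-class, and the product of the pair not at
all. -/
theorem IsSeedReduced.shift (h : IsSeedReduced (P ++ a :: b :: Q))
    (ha : greenR _ (wordVal a) (wordVal a')) (hb : greenL _ (wordVal b) (wordVal b'))
    (hab : wordVal (a ++ b) = wordVal (a' ++ b')) :
    IsSeedReduced (P ++ a' :: b' :: Q) ∧
      SameFingerprint (P ++ a :: b :: Q) (P ++ a' :: b' :: Q) := by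
  constructor
  · obtain ⟨h1, h2⟩ := h
    simp only [List.mem_append, List.mem_cons, List.isChain_append, List.isChain_cons] at h1 h2
    refine ⟨?_, ?_⟩
    · intro x hx
      simp only [List.mem_append, List.mem_cons] at hx
      rcases hx with hx | rfl | rfl | hx
      · exact h1 x (by simp [hx])
      · exact (h1 a (by simp)).of_greenR ha
      · exact (h1 b (by simp)).of_greenL hb
      · exact h1 x (by simp [hx])
    · simp only [List.isChain_append, List.isChain_cons]
      refine ⟨h2.1, ⟨?_, fun y hy hs => ?_, h2.2.1.2.2⟩, ?_⟩
      · rintro _ ⟨⟩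
        rw [← hasSeed_congr hab]
        exact h2.2.1.1 b rfl
      · refine h2.2.1.2.1 y hy (hs.of_greenL ?_)
        rw [wordVal_append, wordVal_append]
        exact greenL_mul_right _ (Setoid.symm' _ hb)
      · rintro x hx _ ⟨⟩ hs
        refine h2.2.2 x hx a rfl (hs.of_greenR ?_)
        rw [wordVal_append, wordVal_append]
        exact greenR_mul_left _ (Setoid.symm' _ ha)
  · refine SameFingerprint.append_left P
      ⟨.cons ?_ (.cons ?_ (SameFingerprint.refl Q).greenD), ?_, ?_⟩
    · exact (le_sup_left : greenR _ ≤ greenD _) ha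
    · exact (le_sup_right : greenL _ ≤ greenD _) hb
    · rintro x ⟨⟩ y ⟨⟩
      exact ha
    · intro x hx y hy
      rcases List.eq_nil_or_concat Q with rfl | ⟨Q, z, rfl⟩
      · obtain rfl : b = x := by simpa using hx
        obtain rfl : b' = y := by simpa using hy
        exact hb
      · obtain rfl : z = x := by simpa [List.getLast?_cons] using hx
        obtain rfl : z = y := by simpa [List.getLast?_cons] using hy
        exact Setoid.refl' _ _

/-- Suppose the relation holds. Dropping left factors reduces to the case where `t` lies in the
member `b` right after `a`; then `a b ℒ b`, so `a b` would have a seed. -/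
theorem IsSeedReduced.not_greenL {c d : List (Idempotents S)} {t : Idempotents S}
    (h : IsSeedReduced (a :: P)) (hP : P.flatten = c ++ t :: d) :
    ¬ greenL _ (letterVal t) (wordVal a * wordVal c * letterVal t) := by
  induction P generalizing a c with
  | nil => simp at hP
  | cons b P ih =>
    intro hl
    have hbP : IsSeedReduced (b :: P) := IsSeedReduced.of_append_right (P := [a]) h
    rw [List.flatten_cons] at hP
    have later : ∀ as, c = b ++ as → P.flatten = as ++ t :: d → False := by
      rintro as rfl hP
      refine ih hbP hP ?_
      rw [wordVal_append] at hl
      exact greenL_mul_of_greenL_mul_mul hl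
    rcases List.append_eq_append_iff.1 hP with ⟨as, h1, h2⟩ | ⟨bs, h1, h2⟩
    · exact later as h1 h2
    · rcases bs with - | ⟨_, bs⟩
      · exact later [] (by simpa using h1.symm) (by simpa using h2.symm)
      · simp only [List.cons_append, List.cons.injEq] at h2
        obtain ⟨rfl, rfl⟩ := h2
        refine IsSeedReduced.not_hasSeed (P := []) h ((hbP.1 b (by simp)).of_greenL ?_)
        have h3 := greenL_mul_right (wordVal bs)
          (Setoid.trans' _ (Setoid.symm' _ (greenL_mul_of_greenL_mul_mul hl)) hl)
        simpa [h1, mul_assoc] using h3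

/-- If a reduced sequence starts with `a`, and `a r` is a prefix of its product that has a seed,
then this prefix ends inside the second member. -/
theorem IsSeedReduced.exists_of_hasSeed_append {r s : List (Idempotents S)}
    (h : IsSeedReduced (a :: P)) (hr : r ≠ []) (hP : P.flatten = r ++ s) (hs : HasSeed (a ++ r)) :
    ∃ r' P', P = (r ++ r') :: P' ∧ greenR _ (wordVal a) (wordVal (a ++ r)) ∧
      greenL _ (wordVal (r ++ r')) (wordVal r') := by
  have ha : greenR _ (wordVal a) (wordVal (a ++ r)) := by
    obtain ⟨c, t, d, hw, hl, hr⟩ := hs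
    -- A seed of `a r` lying in `r` is excluded by `not_greenL`; it lies in `a`, whence `a ℛ a r`.
    have later : ∀ as, c = a ++ as → r = as ++ t :: d → False := by
      rintro as rfl rfl
      refine h.not_greenL (c := as) (t := t) (d := d ++ s) (by simpa using hP) ?_
      rwa [wordVal_append] at hl
    rcases List.append_eq_append_iff.1 hw with ⟨as, h1, h2⟩ | ⟨bs, h1, h2⟩
    · exact (later as h1 h2).elim
    · rcases bs with - | ⟨_, bs⟩
      · exact (later [] (by simpa using h1.symm) (by simpa using h2.symm)).elim
      · simp only [List.cons_append, List.cons.injEq] at h2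
        obtain ⟨rfl, rfl⟩ := h2
        rw [wordVal_append] at hr
        have h3 := greenR_mul_left (wordVal c)
          (Setoid.trans' _ (Setoid.symm' _ (greenR_mul_of_greenR_mul_mul hr)) hr)
        simpa [h1, mul_assoc] using h3
  rcases P with - | ⟨b, P⟩
  · exact absurd (List.append_eq_nil_iff.1 hP.symm).1 hr
  have hab : ¬ HasSeed (a ++ b) := IsSeedReduced.not_hasSeed (P := []) h
  have hb : HasSeed b := h.1 b (by simp)
  have not_greenR : ¬ greenR _ (wordVal a) (wordVal (a ++ b)) := fun h' =>
    hab ((h.1 a (by simp)).of_greenR h')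
  rw [List.flatten_cons] at hP
  rcases List.append_eq_append_iff.1 hP with ⟨as, rfl, -⟩ | ⟨r', rfl, -⟩
  · refine (not_greenR ?_).elim
    rw [wordVal_append, wordVal_append] at ha
    rw [wordVal_append]
    exact greenR_mul_of_greenR_mul_mul ha
  refine ⟨r', P, rfl, ha, ?_⟩
  obtain ⟨c, t, d, hw, hl, hr⟩ := hb
  -- The seed of the second member lies in `r'`: if it were in `r`, then `a ℛ a r ℛ a b`, and `a b`
  -- would have a seed.
  have later : ∀ as, c = r ++ as → r' = as ++ t :: d →
      greenL _ (wordVal (r ++ r')) (wordVal r') := by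
    rintro as rfl rfl
    rw [wordVal_append] at hl
    have h3 := greenL_mul_right (wordVal d)
      (Setoid.trans' _ (Setoid.symm' _ hl) (greenL_mul_of_greenL_mul_mul hl))
    simpa [mul_assoc] using h3
  rcases List.append_eq_append_iff.1 hw with ⟨as, h1, h2⟩ | ⟨bs, h1, h2⟩
  · exact later as h1 h2
  · rcases bs with - | ⟨_, bs⟩
    · exact later [] (by simpa using h1.symm) (by simpa using h2.symm)
    · simp only [List.cons_append, List.cons.injEq] at h2
      obtain ⟨rfl, rfl⟩ := h2
      refine (not_greenR (Setoid.trans' _ ha ?_)).elim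
      rw [wordVal_append] at hr
      have h3 := greenR_mul_left (wordVal a * wordVal c)
        (Setoid.trans' _ (Setoid.symm' _ (greenR_mul_of_greenR_mul_mul hr)) hr)
      simpa [h1, mul_assoc] using h3

/-- One of the two first members is a prefix of the other. Shifting the excess letters out of the
second member makes the first members equal, and induction applies to the rest. -/
theorem sameFingerprint_of_flatten_eq {p q : List (List (Idempotents S))} (hp : IsSeedReduced p)
    (hq : IsSeedReduced q) (h : p.flatten = q.flatten) : SameFingerprint p q := by
  induction hn : p.length generalizing p q with
  | zero =>
    obtain rfl := List.length_eq_zero_iff.1 hn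
    rcases q with - | ⟨b, Q⟩
    · exact .refl _
    · simp only [List.flatten_nil, List.flatten_cons] at h
      exact absurd (List.append_eq_nil_iff.1 h.symm).1 (hq.ne_nil b (by simp))
  | succ n ih =>
    rcases p with - | ⟨a, P⟩
    · simp at hn
    rcases q with - | ⟨b, Q⟩
    · simp only [List.flatten_nil, List.flatten_cons] at h
      exact absurd (List.append_eq_nil_iff.1 h).1 (hp.ne_nil a (by simp))
    have hP : IsSeedReduced P := IsSeedReduced.of_append_right (P := [a]) hp
    have hQ : IsSeedReduced Q := IsSeedReduced.of_append_right (P := [b]) hq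
    simp only [List.length_cons, add_left_inj] at hn
    rw [List.flatten_cons, List.flatten_cons] at h
    rcases List.append_eq_append_iff.1 h with ⟨r, rfl, h2⟩ | ⟨r, rfl, h2⟩
    · rcases eq_or_ne r [] with rfl | hr
      · rw [List.append_nil]
        exact (ih hP hQ (by simpa using h2) hn).cons a
      · obtain ⟨r', P', rfl, hR, hL⟩ := hp.exists_of_hasSeed_append hr h2 (hq.1 _ (by simp))
        obtain ⟨h3, h4⟩ := IsSeedReduced.shift (P := []) hp hR hL (by simp)
        refine h4.trans (.cons _ (ih (IsSeedReduced.of_append_right (P := [a ++ r]) h3) hQ ?_ hn))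
        simpa using h2
    · rcases eq_or_ne r [] with rfl | hr
      · rw [List.append_nil]
        exact (ih hP hQ (by simpa using h2.symm) hn).cons b
      · obtain ⟨r', Q', rfl, hR, hL⟩ := hq.exists_of_hasSeed_append hr h2 (hp.1 _ (by simp))
        obtain ⟨h3, h4⟩ := IsSeedReduced.shift (P := []) hq hR hL (by simp)
        refine (SameFingerprint.cons _ (ih hP (IsSeedReduced.of_append_right (P := [b ++ r]) h3)
          ?_ hn)).trans h4.symm
        simpa using h2.symm

theorem exists_eq_append_cons_of_flatten_eq {A : Type*} {p : List (List A)} {x z : List A} {e : A}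
    (hp : ∀ w ∈ p, w ≠ []) (h : p.flatten = x ++ e :: z) :
    ∃ P b c Q, p = P ++ (b ++ e :: c) :: Q ∧ x = P.flatten ++ b ∧ z = c ++ Q.flatten := by
  rcases List.flatten_eq_append_iff.1 h with
    ⟨as, bs, rfl, rfl, h2⟩ | ⟨as, bs, c, cs, ds, rfl, rfl, h2⟩
  · rcases bs with - | ⟨- | ⟨e', b⟩, bs⟩
    · simp at h2
    · exact absurd rfl (hp [] (by simp))
    · simp only [List.flatten_cons, List.cons_append, List.cons.injEq] at h2
      obtain ⟨rfl, rfl⟩ := h2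
      exact ⟨as, [], b, bs, rfl, by simp, rfl⟩
  · simp only [List.cons_append, List.cons.injEq] at h2
    obtain ⟨rfl, rfl⟩ := h2
    exact ⟨as, bs, cs, ds, rfl, rfl, rfl⟩

/-- Only a step across a border `(b e)(f c)` matters. There `e ∗ f` joins the left member if it is
`ℛ`-related to `e`, the right one if it is `ℒ`-related to `f`, and the result is a shift. -/
theorem IsSeedReduced.exists_of_basicStep {p : List (List (Idempotents S))}
    {u v : List (Idempotents S)} (hp : IsSeedReduced p) (hu : p.flatten = u) (h : BasicStep u v) :
    ∃ q, IsSeedReduced q ∧ q.flatten = v ∧ SameFingerprint p q := by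
  obtain ⟨x, e, f, h, y⟩ := h
  have hg := letterVal_mul_of_basicPair h
  obtain ⟨P, b, c, Q, rfl, rfl, h2⟩ := exists_eq_append_cons_of_flatten_eq hp.ne_nil hu
  clear hu
  rcases c with - | ⟨_, c⟩
  · rcases Q with - | ⟨- | ⟨_, c⟩, Q⟩
    · simp at h2
    · exact absurd rfl (hp.ne_nil [] (by simp))
    simp only [List.flatten_cons, List.nil_append, List.cons_append, List.cons.injEq] at h2
    obtain ⟨rfl, rfl⟩ := h2
    have hn := hp.not_hasSeed
    have hb := hp.1 (b ++ [e]) (by simp)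
    have hc := hp.1 (f :: c) (by simp)
    rcases h.greenR_or_greenL with h1 | h1
    -- If `f` were the seed of `f c`, then `b e ℛ b e f c`, and the product of the neighbours would
    -- have a seed. So the seed lies in `c`.
    · have hL : greenL _ (wordVal (f :: c)) (wordVal c) := by
        obtain ⟨w, t, d, hw, hl, hr⟩ := hc
        rcases w with - | ⟨_, w⟩
        · simp only [List.nil_append, List.cons.injEq] at hw
          obtain ⟨rfl, rfl⟩ := hw
          refine (hn (hb.of_greenR ?_)).elim
          have h3 := greenR_mul_left (letterVal e) hr
          rw [hg] at h3
          simpa [mul_assoc] using greenR_mul_left (wordVal b) (Setoid.trans' _ h1 h3)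
        · simp only [List.cons_append, List.cons.injEq] at hw
          obtain ⟨rfl, rfl⟩ := hw
          rw [wordVal_cons] at hl
          have h3 := greenL_mul_right (wordVal d)
            (Setoid.trans' _ (Setoid.symm' _ hl) (greenL_mul_of_greenL_mul_mul hl))
          simpa [mul_assoc] using h3
      obtain ⟨h3, h4⟩ := hp.shift (a' := b ++ [h.star]) (b' := c)
        (by simpa using greenR_mul_left (wordVal b) h1) hL (by simp [← hg, mul_assoc])
      exact ⟨_, h3, by simp, h4⟩
    · have hR : greenR _ (wordVal (b ++ [e])) (wordVal b) := by
        obtain ⟨w, t, d, hw, hl, hr⟩ := hb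
        have last : b = w → t = e → False := by
          rintro rfl rfl
          refine hn (hc.of_greenL ?_)
          have h3 := greenL_mul_right (letterVal f) hl
          rw [hg] at h3
          have h4 := greenL_mul_right (wordVal c) (Setoid.trans' _ h1 h3)
          simpa [mul_assoc] using h4
        rcases List.append_eq_append_iff.1 hw with ⟨as, h5, h6⟩ | ⟨bs, h5, h6⟩
        · rcases as with - | ⟨_, as⟩
          · simp only [List.nil_append, List.cons.injEq] at h6
            exact (last (by simpa using h5.symm) h6.1.symm).elim
          · simp at h6
        · rcases bs with - | ⟨_, bs⟩
          · simp only [List.nil_append, List.cons.injEq] at h6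
            exact (last (by simpa using h5) h6.1).elim
          · simp only [List.cons_append, List.cons.injEq] at h6
            obtain ⟨rfl, rfl⟩ := h6
            rw [wordVal_append] at hr
            have h3 := greenR_mul_left (wordVal w)
              (Setoid.trans' _ (Setoid.symm' _ hr) (greenR_mul_of_greenR_mul_mul hr))
            simpa [h5, mul_assoc] using h3
      obtain ⟨h3, h4⟩ := hp.shift (a' := b) (b' := h.star :: c) hR
        (by simpa using greenL_mul_right (wordVal c) h1) (by simp [← hg, mul_assoc])
      exact ⟨_, h3, by simp, h4⟩
  · simp only [List.cons_append, List.cons.injEq] at h2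
    obtain ⟨rfl, rfl⟩ := h2
    obtain ⟨h3, h4⟩ := hp.replace (a' := b ++ h.star :: c) (by simp [← hg, mul_assoc])
    exact ⟨_, h3, by simp, h4⟩

theorem IsSeedReduced.exists_of_basicStep_symm {p : List (List (Idempotents S))}
    {u v : List (Idempotents S)} (hp : IsSeedReduced p) (hv : p.flatten = v) (h : BasicStep u v) :
    ∃ q, IsSeedReduced q ∧ q.flatten = u ∧ SameFingerprint p q := by
  obtain ⟨x, e, f, h, y⟩ := h
  have hg := letterVal_mul_of_basicPair h
  obtain ⟨P, b, c, Q, rfl, rfl, rfl⟩ := exists_eq_append_cons_of_flatten_eq hp.ne_nil hv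
  obtain ⟨h3, h4⟩ := hp.replace (a' := b ++ e :: f :: c) (by simp [← hg, mul_assoc])
  exact ⟨_, h3, by simp, h4⟩

theorem sameFingerprint_of_wordVal_eq {p q : List (List (Idempotents S))} (hp : IsSeedReduced p)
    (hq : IsSeedReduced q) (h : wordVal p.flatten = wordVal q.flatten) : SameFingerprint p q := by
  have key : ∀ u v : List (Idempotents S), Relation.EqvGen BasicStep u v →
      (∀ p, IsSeedReduced p → p.flatten = u →
        ∃ q, IsSeedReduced q ∧ q.flatten = v ∧ SameFingerprint p q) ∧
      (∀ p, IsSeedReduced p → p.flatten = v →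
        ∃ q, IsSeedReduced q ∧ q.flatten = u ∧ SameFingerprint p q) := by
    intro u v huv
    induction huv with
    | rel _ _ h =>
      exact ⟨fun p hp hu => hp.exists_of_basicStep hu h,
        fun p hp hv => hp.exists_of_basicStep_symm hv h⟩
    | refl _ => exact ⟨fun p hp hu => ⟨p, hp, hu, .refl p⟩, fun p hp hu => ⟨p, hp, hu, .refl p⟩⟩
    | symm _ _ _ ih => exact ih.symm
    | trans _ _ _ _ _ ih1 ih2 =>
      constructor
      · intro p hp hu
        obtain ⟨q, hq, hv, h⟩ := ih1.1 p hp hu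
        obtain ⟨r, hr, hw, h'⟩ := ih2.1 q hq hv
        exact ⟨r, hr, hw, h.trans h'⟩
      · intro p hp hu
        obtain ⟨q, hq, hv, h⟩ := ih2.2 p hp hu
        obtain ⟨r, hr, hw, h'⟩ := ih1.2 q hq hv
        exact ⟨r, hr, hw, h.trans h'⟩
  obtain ⟨r, hr, hrq, hpr⟩ := (key _ _ (eqvGen_basicStep_of_wordVal_eq h)).1 p hp rfl
  exact hpr.trans (sameFingerprint_of_flatten_eq hr hq hrq)

end Reduced

/-! ### Regular elements are those with seeds -/

section Regular

variable {S : Type*} [Semigroup S]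

theorem HasSeed.greenR_or_greenL_of_append {u v : List (Idempotents S)} (h : HasSeed (u ++ v)) :
    HasSeed u ∧ greenR _ (wordVal u) (wordVal (u ++ v)) ∨
      HasSeed v ∧ greenL _ (wordVal v) (wordVal (u ++ v)) := by
  obtain ⟨a, t, b, hw, hl, hr⟩ := h
  have right : ∀ as, a = u ++ as → v = as ++ t :: b →
      HasSeed v ∧ greenL _ (wordVal v) (wordVal (u ++ v)) := by
    rintro as rfl rfl
    rw [wordVal_append] at hl
    have h1 := greenL_mul_of_greenL_mul_mul hl
    refine ⟨⟨as, t, b, rfl, h1, hr⟩, ?_⟩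
    have h2 := greenL_mul_right (wordVal b) (Setoid.trans' _ (Setoid.symm' _ h1) hl)
    simpa [mul_assoc] using h2
  rcases List.append_eq_append_iff.1 hw with ⟨as, h1, h2⟩ | ⟨bs, h1, h2⟩
  · exact Or.inr (right as h1 h2)
  · rcases bs with - | ⟨_, bs⟩
    · exact Or.inr (right [] (by simpa using h1.symm) (by simpa using h2.symm))
    · simp only [List.cons_append, List.cons.injEq] at h2
      obtain ⟨rfl, rfl⟩ := h2
      subst h1
      rw [wordVal_append] at hr
      have h1 := greenR_mul_of_greenR_mul_mul hr
      refine Or.inl ⟨⟨a, t, bs, rfl, hl, h1⟩, ?_⟩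
      have h2 := greenR_mul_left (wordVal a) (Setoid.trans' _ (Setoid.symm' _ h1) hr)
      simpa [mul_assoc] using h2

/-- A word with a seed, placed between two reduced sequences, absorbs consecutive members on both
sides until the whole sequence is reduced. -/
theorem exists_isSeedReduced_absorb {P Q : List (List (Idempotents S))} {b : List (Idempotents S)}
    (hP : IsSeedReduced P) (hQ : IsSeedReduced Q) (hb : HasSeed b) :
    ∃ P₁ P₂ Q₁ Q₂, P = P₁ ++ P₂ ∧ Q = Q₁ ++ Q₂ ∧
      IsSeedReduced (P₁ ++ (P₂.flatten ++ b ++ Q₁.flatten) :: Q₂) := by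
  induction hn : P.length + Q.length generalizing P Q b with
  | zero =>
    obtain ⟨h1, h2⟩ := Nat.add_eq_zero_iff.1 hn
    obtain rfl := List.length_eq_zero_iff.1 h1
    obtain rfl := List.length_eq_zero_iff.1 h2
    exact ⟨[], [], [], [], rfl, rfl, by simpa using isSeedReduced_singleton hb⟩
  | succ n ih =>
    by_cases h1 : ∃ x ∈ P.getLast?, HasSeed (x ++ b)
    · obtain ⟨x, hx, hxb⟩ := h1
      obtain ⟨P, rfl⟩ := List.getLast?_eq_some_iff.1 hx
      obtain ⟨P₁, P₂, Q₁, Q₂, rfl, rfl, h⟩ := ih hP.of_append_left hQ hxb (by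
        simp only [List.length_append, List.length_singleton] at hn
        omega)
      exact ⟨P₁, P₂ ++ [x], Q₁, Q₂, by simp, rfl, by simpa using h⟩
    by_cases h2 : ∃ y ∈ Q.head?, HasSeed (b ++ y)
    · obtain ⟨y, hy, hby⟩ := h2
      rcases Q with - | ⟨_, Q⟩
      · simp at hy
      obtain rfl : _ = y := by simpa using hy
      obtain ⟨P₁, P₂, Q₁, Q₂, rfl, rfl, h⟩ := ih hP
        (IsSeedReduced.of_append_right (P := [_]) hQ) hby (by
          simp only [List.length_cons] at hn
          omega)
      exact ⟨P₁, P₂, _ :: Q₁, Q₂, rfl, rfl, by simpa using h⟩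
    · push Not at h1 h2
      refine ⟨P, [], [], Q, by simp, rfl, ?_, ?_⟩
      · intro x hx
        simp only [List.flatten_nil, List.nil_append, List.append_nil, List.mem_append,
          List.mem_cons] at hx
        rcases hx with hx | rfl | hx
        exacts [hP.1 x hx, hb, hQ.1 x hx]
      · simp only [List.flatten_nil, List.nil_append, List.append_nil, List.isChain_append,
          List.isChain_cons]
        refine ⟨hP.2, ⟨h2, hQ.2⟩, ?_⟩
        rintro x hx _ ⟨⟩
        exact h1 x hx

theorem exists_isSeedReduced (w : List (Idempotents S)) :
    ∃ p, IsSeedReduced p ∧ p.flatten = w := by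
  induction w with
  | nil => exact ⟨[], ⟨by simp, by simp⟩, rfl⟩
  | cons e w ih =>
    obtain ⟨p, hp, rfl⟩ := ih
    obtain ⟨P₁, P₂, Q₁, Q₂, h1, rfl, h⟩ := exists_isSeedReduced_absorb (P := [])
      ⟨by simp, by simp⟩ hp (hasSeed_singleton e)
    obtain ⟨rfl, rfl⟩ := List.append_eq_nil_iff.1 h1.symm
    exact ⟨_, h, by simp⟩

theorem IsSeedReduced.length_eq_one {p : List (List (Idempotents S))} (hp : IsSeedReduced p)
    (h : HasSeed p.flatten) : p.length = 1 :=
  (sameFingerprint_of_flatten_eq hp (isSeedReduced_singleton h) (by simp)).length_eq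

/-- Let `p` be a reduced factorisation of `w`. Since `w w` and `w` have equal values, every reduced
factorisation of `w w` has as many members as `p`; this restricts how much can merge where two
copies of `p` meet. -/
theorem hasSeed_of_isIdempotentElem {w : List (Idempotents S)} (hw : w ≠ [])
    (h : IsIdempotentElem (wordVal w)) : HasSeed w := by
  obtain ⟨p, hp, rfl⟩ := exists_isSeedReduced w
  obtain ⟨a, P, rfl⟩ : ∃ a P, p = a :: P := List.exists_cons_of_ne_nil (by rintro rfl; simp at hw)
  obtain ⟨P', z, hz⟩ := (List.eq_nil_or_concat (a :: P)).resolve_left (by simp)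
  rw [List.concat_eq_append] at hz
  have hlen : P.length = P'.length := by simpa using congrArg List.length hz
  have hww : wordVal ((a :: P).flatten ++ (a :: P).flatten) = wordVal (a :: P).flatten := by
    rw [wordVal_append, h.eq]
  have hP : IsSeedReduced P := IsSeedReduced.of_append_right (P := [a]) hp
  have hp' := hp
  rw [hz] at hp'
  by_cases hza : HasSeed (z ++ a)
  -- Comparing lengths gives `|P₁| = |Q₁|` and `|P₂| = |Q₂|`. The merged block is the product of `P₂
  -- z` and `a Q₁`, one of which carries its seed.
  · obtain ⟨P₁, P₂, Q₁, Q₂, rfl, rfl, hq⟩ :=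
      exists_isSeedReduced_absorb hp'.of_append_left hP hza
    have hl := (sameFingerprint_of_wordVal_eq hq hp (by
      rw [← hww]
      nth_rewrite 1 [hz]
      simp)).length_eq
    have hB := hq.1 (P₂.flatten ++ (z ++ a) ++ Q₁.flatten) (by simp)
    rw [show P₂.flatten ++ (z ++ a) ++ Q₁.flatten = (P₂ ++ [z]).flatten ++ (a :: Q₁).flatten by
      simp] at hB
    simp only [List.length_append, List.length_cons] at hl hlen
    rcases hB.greenR_or_greenL_of_append with ⟨h1, h2⟩ | ⟨h1, h2⟩
    -- A reduced sequence whose product has a seed is a single member, so `P₂` and `Q₂` are empty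
    -- and the block is `z w`. It is `ℒ`-related to `w` because `w = w w = P₁ z w`.
    · rw [List.append_assoc] at hp'
      have h3 := hp'.of_append_right.length_eq_one h1
      simp only [List.length_append, List.length_singleton] at h3
      obtain rfl := List.length_eq_zero_iff.1 (show P₂.length = 0 by omega)
      obtain rfl := List.length_eq_zero_iff.1 (show Q₂.length = 0 by simp only [List.length_nil] at hl hlen; omega)
      simp only [List.append_nil] at *
      refine (h1.of_greenR h2).of_greenL (greenL_iff_exists.2 ⟨⟨wordVal P₁.flatten, ?_⟩,
        ⟨wordVal z, by simp⟩⟩)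
      rw [← hww]
      nth_rewrite 1 [hz]
      simp
    -- Dually, the block is `w a`, and `w = w w = w a Q₂` makes it `ℛ`-related to `w`.
    · have h3 := IsSeedReduced.length_eq_one (p := a :: Q₁)
        (IsSeedReduced.of_append_left (Q := Q₂) hp) h1
      simp only [List.length_cons] at h3
      obtain rfl := List.length_eq_zero_iff.1 (show Q₁.length = 0 by omega)
      obtain rfl := List.length_eq_zero_iff.1 (show P₁.length = 0 by simp only [List.length_nil] at hl; omega)
      simp only [List.nil_append] at *
      have hza' : wordVal P₂.flatten * wordVal z = wordVal a * wordVal Q₂.flatten := by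
        simpa using congrArg (fun p => wordVal p.flatten) hz.symm
      refine (h1.of_greenL h2).of_greenR (greenR_iff_dvd.2 ⟨⟨wordVal Q₂.flatten, ?_⟩,
        ⟨wordVal a, by simp [← mul_assoc, hza']⟩⟩)
      rw [← hww]
      simp [← mul_assoc, hza']
  -- Nothing merges, so two copies of `p` form a reduced sequence of twice the length.
  · have hpp : IsSeedReduced ((a :: P) ++ (a :: P)) := by
      refine ⟨fun x hx => hp.1 x ((List.mem_append.1 hx).elim id id), List.isChain_append.2 ⟨hp.2, hp.2, ?_⟩⟩
      intro x hx y hy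
      obtain rfl : a = y := by simpa using hy
      obtain rfl : z = x := by simpa [hz] using hx
      exact hza
    have hl := (sameFingerprint_of_wordVal_eq hpp hp (by rw [← hww, List.flatten_append])).length_eq
    simp at hl

/-- If `x y x = x`, then `x y` is an idempotent `ℛ`-related to `x`. Conversely, if `c a t = t = t b
d`, then `d t c` is an inner inverse of `a t b`. -/
theorem isRegularElem_bar_iff_hasSeed {x : FreeSemigroup (Idempotents S)} :
    IsRegularElem (IG.bar x) ↔ HasSeed x.letters := by
  constructor
  · rintro ⟨b, hb⟩
    obtain ⟨y, rfl⟩ : ∃ u, IG.bar u = b := Quot.exists_rep b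
    have hxyx : wordVal x.letters * wordVal y.letters * wordVal x.letters = wordVal x.letters := by
      simp only [wordVal_letters, ← WithOne.coe_mul, hb]
    refine (hasSeed_of_isIdempotentElem (w := x.letters ++ y.letters)
      (by simp [letters_ne_nil]) ?_).of_greenR (greenR_iff_dvd.2 ⟨⟨wordVal x.letters, ?_⟩,
        ⟨wordVal y.letters, by rw [wordVal_append]⟩⟩)
    · rw [IsIdempotentElem, wordVal_append, ← mul_assoc, hxyx]
    · rw [wordVal_append, hxyx]
  · rintro ⟨a, t, b, hx, hl, hr⟩
    obtain ⟨-, c, hc⟩ := greenL_iff_exists.1 hl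
    obtain ⟨-, d, hd⟩ := greenR_iff_dvd.1 hr
    obtain ⟨c, rfl⟩ := wordVal_surjective c
    obtain ⟨d, rfl⟩ := wordVal_surjective d
    obtain ⟨y, hy⟩ := exists_letters_eq (w := d ++ t :: c) (by simp)
    refine ⟨IG.bar y, ?_⟩
    rw [← WithOne.coe_inj, WithOne.coe_mul, WithOne.coe_mul, ← wordVal_letters,
      ← wordVal_letters, hx, hy]
    simp only [wordVal_append, wordVal_cons]
    calc _ = wordVal a * (letterVal t * wordVal b * wordVal d) * letterVal t *
          (wordVal c * (wordVal a * letterVal t)) * wordVal b := by simp only [mul_assoc]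
      _ = _ := by
        rw [← hd, ← hc, mul_assoc (wordVal a), letterVal_mul_self, mul_assoc (wordVal a),
          letterVal_mul_self, mul_assoc]

end Regular

/-! ### Minimal r-factorisations -/

section MinimalFactorisations

variable {S : Type*} [Semigroup S]

theorem forall₂_isFactorisation_singleton {A : Type*} (p : List (FreeSemigroup A)) :
    List.Forall₂ IsFactorisation p (p.map fun x => [x]) := by
  induction p with
  | nil => exact .nil
  | cons x p ih => exact .cons (by simp [IsFactorisation]) ih

theorem coarser_mul {A : Type*} (P Q : List (FreeSemigroup A)) (x y : FreeSemigroup A) :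
    Coarser (P ++ (x * y) :: Q) (P ++ x :: y :: Q) := by
  refine ⟨P.map (fun x => [x]) ++ [x, y] :: Q.map fun x => [x], ?_, ?_⟩
  · simp [← List.flatMap_def]
  · exact List.rel_append (forall₂_isFactorisation_singleton P)
      (.cons (by simp [IsFactorisation, letters_mul]) (forall₂_isFactorisation_singleton Q))

theorem Coarser.length_le {A : Type*} {p q : List (FreeSemigroup A)} (h : Coarser p q) :
    p.length ≤ q.length ∧ (p.length = q.length → p = q) := by
  obtain ⟨blocks, rfl, h⟩ := h
  induction h with
  | nil => simp
  | @cons x B p Bs hx _ ih =>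
    rcases B with - | ⟨y, - | ⟨y', B⟩⟩
    · exact absurd hx.symm (letters_ne_nil x)
    · obtain rfl : y = x := letters_injective (by simpa [IsFactorisation] using hx)
      simpa using ih
    · simp only [List.length_cons, List.flatten_cons, List.length_append]
      constructor <;> omega

theorem IsMinimalRFactorisation.isSeedReduced {w : FreeSemigroup (Idempotents S)}
    {p : List (FreeSemigroup (Idempotents S))} (h : IsMinimalRFactorisation w p) :
    IsSeedReduced (p.map FreeSemigroup.letters) := by
  obtain ⟨⟨h1, h2⟩, h3⟩ := h
  refine ⟨?_, ?_⟩
  · intro _ hx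
    obtain ⟨x, hxp, rfl⟩ := List.mem_map.1 hx
    exact isRegularElem_bar_iff_hasSeed.1 (h2 x hxp)
  · rw [List.isChain_map, List.isChain_iff_forall_rel_of_append_cons_cons]
    rintro x y P Q rfl hs
    rw [← letters_mul, ← isRegularElem_bar_iff_hasSeed] at hs
    have h4 := h3 (P ++ (x * y) :: Q) ⟨?_, ?_⟩ (coarser_mul P Q x y)
    · simpa using congrArg List.length h4
    · simpa [IsFactorisation, letters_mul] using h1
    · intro z hz
      simp only [List.mem_append, List.mem_cons] at hz
      rcases hz with hz | rfl | hz
      exacts [h2 z (by simp [hz]), hs, h2 z (by simp [hz])]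

/-- An r-factorisation with the fewest factors is minimal, since a coarser one of the same length is
equal to it. -/
theorem exists_isMinimalRFactorisation (w : FreeSemigroup (Idempotents S)) :
    ∃ p, IsMinimalRFactorisation w p := by
  have hne : {p | IsRFactorisation w p}.Nonempty := by
    obtain ⟨p, hp, hw⟩ := exists_isSeedReduced w.letters
    obtain ⟨p, rfl⟩ : ∃ q : List (FreeSemigroup (Idempotents S)),
        q.map FreeSemigroup.letters = p := by
      have := hp.ne_nil
      rw [← Set.mem_range, Set.range_list_map]
      exact fun x hx => exists_letters_eq (this x hx)
    exact ⟨p, hw, fun x hx => isRegularElem_bar_iff_hasSeed.2 (hp.1 _ (List.mem_map_of_mem hx))⟩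
  obtain ⟨p, hp, hmin⟩ := (measure List.length).wf.has_min _ hne
  refine ⟨p, hp, fun q hq hqp => hqp.length_le.2 (le_antisymm hqp.length_le.1 ?_)⟩
  exact not_lt.1 (hmin q hq)

theorem IsMinimalRFactorisation.sameFingerprint {u v : FreeSemigroup (Idempotents S)}
    {p q : List (FreeSemigroup (Idempotents S))} (hp : IsMinimalRFactorisation u p)
    (hq : IsMinimalRFactorisation v q) (h : IG.bar u = IG.bar v) :
    SameFingerprint (p.map FreeSemigroup.letters) (q.map FreeSemigroup.letters) := by
  have hu : (p.map FreeSemigroup.letters).flatten = u.letters := hp.1.1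
  have hv : (q.map FreeSemigroup.letters).flatten = v.letters := hq.1.1
  refine sameFingerprint_of_wordVal_eq hp.isSeedReduced hq.isSeedReduced ?_
  rw [hu, hv, wordVal_letters, wordVal_letters, h]

theorem IsMinimalRFactorisation.dClasses_eq {u v : FreeSemigroup (Idempotents S)}
    {p q : List (FreeSemigroup (Idempotents S))} (hp : IsMinimalRFactorisation u p)
    (hq : IsMinimalRFactorisation v q) (h : IG.bar u = IG.bar v) : dClasses p = dClasses q := by
  have hD := (hp.sameFingerprint hq h).greenD
  rw [List.forall₂_map_left_iff, List.forall₂_map_right_iff] at hD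
  rw [dClasses, dClasses, ← List.forall₂_eq_eq_eq, List.forall₂_map_left_iff,
    List.forall₂_map_right_iff]
  refine hD.imp fun x y hxy => Quotient.sound ?_
  rw [wordVal_letters, wordVal_letters] at hxy
  exact greenD_of_greenD_coe hxy

end MinimalFactorisations

theorem theorem3 (S : Type*) [Semigroup S] [Finite (Idempotents S)] :
    (∀ (u v : FreeSemigroup (Idempotents S)) (_ : IG.bar u = IG.bar v)
      (p q : List (FreeSemigroup (Idempotents S)))
      (hp : IsMinimalRFactorisation u p) (hq : IsMinimalRFactorisation v q),
      p.length = q.length ∧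
      (∀ (i : ℕ) (hi : i < p.length) (hj : i < q.length),
        greenD (IG S) (IG.bar p[i]) (IG.bar q[i])) ∧
      greenR (IG S) (IG.bar (p.head hp.ne_nil)) (IG.bar (q.head hq.ne_nil)) ∧
      greenL (IG S) (IG.bar (p.getLast hp.ne_nil)) (IG.bar (q.getLast hq.ne_nil))) ∧
    (∀ x : IG S, ∃! F : List (Quotient (greenD (IG S))),
      ∀ (w : FreeSemigroup (Idempotents S)) (p : List (FreeSemigroup (Idempotents S))),
        IG.bar w = x → IsMinimalRFactorisation w p → dClasses p = F) := by
  constructor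
  · intro u v h p q hp hq
    have hs := hp.sameFingerprint hq h
    refine ⟨by simpa using hs.length_eq, ?_, ?_, ?_⟩
    · intro i hi hj
      have := (List.forall₂_iff_get.1 hs.greenD).2 i (by simpa using hi) (by simpa using hj)
      simp only [List.get_eq_getElem, List.getElem_map, wordVal_letters] at this
      exact greenD_of_greenD_coe this
    · have := hs.greenR (p.head hp.ne_nil).letters (by simp [List.head?_eq_some_head hp.ne_nil])
        (q.head hq.ne_nil).letters (by simp [List.head?_eq_some_head hq.ne_nil])
      rw [wordVal_letters, wordVal_letters] at this
      exact greenR_of_greenR_coe this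
    · have := hs.greenL (p.getLast hp.ne_nil).letters
        (by simp [List.getLast?_eq_some_getLast hp.ne_nil])
        (q.getLast hq.ne_nil).letters (by simp [List.getLast?_eq_some_getLast hq.ne_nil])
      rw [wordVal_letters, wordVal_letters] at this
      exact greenL_of_greenL_coe this
  · intro x
    obtain ⟨w, rfl⟩ : ∃ u, IG.bar u = x := Quot.exists_rep x
    obtain ⟨p, hp⟩ := exists_isMinimalRFactorisation w
    -- Uniqueness needs an actual minimal r-factorisation of a word for `x`; otherwise every `F`
    -- would qualify.
    exact ⟨dClasses p, fun v q hv hq => hq.dClasses_eq hp hv, fun F hF => (hF w p rfl hp).symm⟩
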